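/- Let $(w,r,\theta,\varphi)$, $0<\theta<\pi$, be coordinates in which a Lorentzian metric $g$ has the Bondi form $$-UV\,dw^2-2U\,dw\,dr+\sigma_{ab}(dx^a+W^a dw)(dx^b+W^b dw),\qquad a,b\in\{\theta,\varphi\},$$ with $C^1$ coefficients, and let $F$ be a 2-form (for instance a solution $(g,F)$ of the Einstein–Maxwell equations). Suppose that, as $r\to\infty$ along each ray of constant $(w,\theta,\varphi)$, $$V=1-\tfrac{2m}{r}+O(r^{-2}),\qquad U=1+O(r^{-2}),\qquad W^a=O(r^{-2}),$$ $$\sigma_{\theta\theta}=r^2+2cr+O(1),\qquad \sigma_{\theta\varphi}=-2dr\sin\theta+O(1),\qquad \sigma_{\varphi\varphi}=\sin^2\theta\,(r^2-2cr)+O(1),$$ where the expansions of $W^a$ and $\sigma_{ab}$ may be differentiated once (the angular derivatives of $W^a$ are $O(r^{-2})$, the first derivatives of the remainders of $\sigma_{ab}$ are $O(1)$), and $$F_{w\theta}=X+O(r^{-1}),\quad F_{w\varphi}=Y\sin\theta+O(r^{-1}),\quad F_{ra}=O(r^{-2}),\quad F_{ab}=O(1),\quad F_{wr}=O(r^{-2}).$$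 Here $m,c,d,X,Y$ are functions of $(w,\theta,\varphi)$, with $c,d$ of class $C^1$. The vector fields $e_3=\partial_w-W^c\partial_c-\frac V2\partial_r$ and $e_4=\partial_r$ are null and normal to the spheres $S_{w,r}$, and $\langle e_3,e_4\rangle\to-1$ as $r\to\infty$. For large $r$ let $T$ and $N$ be the unit timelike and unit spacelike normals of $S_{w,r}$ for which $T-N$ and $T+N$ are positive multiples, with the same factor, of $e_3$ and $e_4$, that is, $T=\frac{e_3+e_4}{\sqrt{-2\langle e_3,e_4\rangle}}$ and $N=\frac{e_4-e_3}{\sqrt{-2\langle e_3,e_4\rangle}}$. On $S_{w,r}$ put $\eta_{ab}=-\langle\nabla_aT,\partial_b\rangle$, $\theta_{ab}=\langle\nabla_aN,\partial_b\rangle$, $\underline\chi'_{ab}=\langle\nabla_a(T-N),\partial_b\rangle$ and $\underline\alpha(F)_a=F(\partial_a,e_3)$; a hat denotes the trace-free part with respect to the induced metric. For a family of tensors on the spheres $S_{w,r}$, limits as $r\to\infty$ on a hypersurface of constant $w$ are taken for the components in the frame $(r^{-1}\partial_\theta,r^{-1}\partial_\varphi)$; they are tensors on the unit sphere $S^2$,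 with components in the frame $(\partial_\theta,\partial_\varphi)$, whose norms are those of the round metric $\mathring\gamma=d\theta^2+\sin^2\theta\,d\varphi^2$, $|\Xi|^2=\mathring\gamma^{aa'}\mathring\gamma^{bb'}\Xi_{ab}\Xi_{a'b'}$ and $|A|^2=\mathring\gamma^{aa'}A_aA_{a'}$. Then the limits $$\Xi=\lim_{r\to\infty}r\,\hat\eta=\lim_{r\to\infty}r\,\hat\theta=-\tfrac12\lim_{r\to\infty}r\,\hat{\underline\chi}',\qquad A_F=\lim_{r\to\infty}r\,\underline\alpha(F)$$ exist, $\Xi$ is symmetric and trace-free, and $$|\Xi|^2=(\partial_wc)^2+(\partial_wd)^2,\qquad |A_F|^2=X^2+Y^2 .$$ Hence the mass loss formula of Zipser and the one of van der Burg agree: with $u=-w$, a function $M$ (for example the Bondi mass $M(w)=\frac1{8\pi}\int_{S^2}m\,d\mu_{\mathring\gamma}$) satisfies $$\frac{\partial M}{\partial u}=\frac1{8\pi}\int_{S^2}\Bigl(|\Xi|^2+\tfrac12|A_F|^2\Bigr)d\mu_{\mathring\gamma}$$ for all $u$, with integrable integrand, if and only if it satisfies $$\frac{\partial M}{\partial w}=-\frac1{8\pi}\int_{S^2}\Bigl((\partial_wc)^2+(\partial_wd)^2+\tfrac12(X^2+Y^2)\Bigr)d\mu_{\mathring\gamma}$$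 for all $w$, with integrable integrand. -/

import Mathlib

noncomputable section

namespace Bondi

open Filter Topology Asymptotics MeasureTheory

/-! ### Coordinates and the Levi-Civita connection in coordinates -/

/-- Coordinate space; the coordinates of a point are `(w, r, θ, φ)`, with indices `0, 1, 2, 3`. -/
abbrev Pt : Type := Fin 4 → ℝ

/-- The point with coordinates `(w, r, θ, φ)`. -/
def pt (w r θ φ : ℝ) : Pt := ![w, r, θ, φ]

/-- The coordinate vector `∂_μ`. -/
def basisVec (μ : Fin 4) : Pt := Pi.single μ 1

/-- The coordinate indices `2` (for `θ`) and `3` (for `φ`) of the angular variables. -/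
def ang : Fin 2 → Fin 4 := ![2, 3]

/-- The partial derivative `∂_μ f`. -/
def pd (μ : Fin 4) (f : Pt → ℝ) (x : Pt) : ℝ := fderiv ℝ f x (basisVec μ)

/-- The Christoffel symbol `Γ^l_{μ ν}` of a metric given by its matrix of components. -/
def christoffel (g : Pt → Matrix (Fin 4) (Fin 4) ℝ) (x : Pt) (l μ ν : Fin 4) : ℝ :=
  (1 / 2) * ∑ κ, (g x)⁻¹ l κ *
    (pd μ (fun y => g y ν κ) x + pd ν (fun y => g y μ κ) x - pd κ (fun y => g y μ ν) x)

/-- The covariant derivative `∇_{∂_μ} n` of a vector field `n`. -/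
def covDeriv (g : Pt → Matrix (Fin 4) (Fin 4) ℝ) (μ : Fin 4) (n : Pt → Pt) (x : Pt) : Pt :=
  fun l => pd μ (fun y => n y l) x + ∑ ν, christoffel g x l μ ν * n x ν

/-! ### Metrics in Bondi form -/

/-- The coefficients of the line element
`- U V dw² - 2 U dw dr + σ_{ab} (dx^a + W^a dw) (dx^b + W^b dw)`. -/
structure Coeffs where
  U : Pt → ℝ
  V : Pt → ℝ
  W : Pt → Fin 2 → ℝ
  σ : Pt → Matrix (Fin 2) (Fin 2) ℝ

namespace Coeffs

variable (B : Coeffs)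

/-- The scalar product `⟨u, v⟩` at `x` of the metric in Bondi form. -/
def ip (x u v : Pt) : ℝ :=
  - B.U x * B.V x * (u 0 * v 0) - B.U x * (u 0 * v 1 + u 1 * v 0)
    + ∑ a, ∑ b, B.σ x a b * (u (ang a) + B.W x a * u 0) * (v (ang b) + B.W x b * v 0)

/-- The matrix of components of the metric. -/
def metric (x : Pt) : Matrix (Fin 4) (Fin 4) ℝ :=
  Matrix.of fun μ ν => B.ip x (basisVec μ) (basisVec ν)

/-- The null vector `e₃ = ∂_w - W^c ∂_c - (V / 2) ∂_r`. -/
def e3 (x : Pt) : Pt := ![1, - B.V x / 2, - B.W x 0, - B.W x 1]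

/-- The null vector `e₄ = ∂_r`. -/
def e4 (_B : Coeffs) (_x : Pt) : Pt := basisVec 1

/-- The unit timelike normal `T` of the surfaces `S_{w,r}` in the direction of `e₃ + e₄`
(recall `⟨e₃, e₄⟩ = - U`). -/
def T (x : Pt) : Pt := (Real.sqrt (-2 * B.ip x (B.e3 x) (B.e4 x)))⁻¹ • (B.e3 x + B.e4 x)

/-- The outward unit spacelike normal `N` of the surfaces `S_{w,r}` that is orthogonal to `T`, so
that `T - N` and `T + N` are the positive multiples of `e₃` and `e₄` with scalar product `-2`. -/
def N (x : Pt) : Pt := (Real.sqrt (-2 * B.ip x (B.e3 x) (B.e4 x)))⁻¹ • (B.e4 x - B.e3 x)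

/-- The second fundamental form `⟨∇_{∂_a} n, ∂_b⟩` of `S_{w,r}` with respect to a normal
vector field `n`. -/
def secondForm (n : Pt → Pt) (x : Pt) : Matrix (Fin 2) (Fin 2) ℝ :=
  Matrix.of fun a b => B.ip x (covDeriv B.metric (ang a) n x) (basisVec (ang b))

/-- The trace-free part, for the induced metric `σ` of `S_{w,r}`, of a covariant 2-tensor. -/
def traceFree (x : Pt) (A : Matrix (Fin 2) (Fin 2) ℝ) : Matrix (Fin 2) (Fin 2) ℝ :=
  A - ((1 / 2) * ∑ a, ∑ b, (B.σ x)⁻¹ a b * A a b) • B.σ x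

/-- `θ_{ab} = ⟨∇_a N, ∂_b⟩`. -/
def theta (x : Pt) : Matrix (Fin 2) (Fin 2) ℝ := B.secondForm B.N x

/-- `η_{ab} = k_{ab} = - ⟨∇_a T, ∂_b⟩`. -/
def eta (x : Pt) : Matrix (Fin 2) (Fin 2) ℝ := - B.secondForm B.T x

/-- The ingoing null second fundamental form `χ̲'_{ab} = ⟨∇_a (T - N), ∂_b⟩`. -/
def chiBar (x : Pt) : Matrix (Fin 2) (Fin 2) ℝ := B.secondForm (fun y => B.T y - B.N y) x

/-- The null component `α̲(F)_a = F(∂_a, e₃)` of a 2-form `F`. -/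
def alphaBar (F : Pt → Matrix (Fin 4) (Fin 4) ℝ) (x : Pt) (a : Fin 2) : ℝ :=
  ∑ ν, F x (ang a) ν * B.e3 x ν

end Coeffs

/-! ### The asymptotics -/

/-- Functions of `(w, θ, φ)`, i.e. functions on null infinity. -/
abbrev ScriFun : Type := ℝ → ℝ → ℝ → ℝ

/-- `f` is `C¹` in `(w, θ, φ)` for `0 < θ < π`. -/
def IsC1 (f : ScriFun) : Prop :=
  ContDiffOn ℝ 1 (fun y : ℝ × ℝ × ℝ => f y.1 y.2.1 y.2.2) {y | y.2.1 ∈ Set.Ioo 0 Real.pi}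

/-- The derivative `∂_w f`. -/
def dw (f : ScriFun) : ScriFun := fun w θ φ => deriv (fun s => f s θ φ) w

/-- The two leading orders of `σ`. -/
def sigmaLead (c d : ScriFun) (x : Pt) : Matrix (Fin 2) (Fin 2) ℝ :=
  let C := c (x 0) (x 2) (x 3)
  let D := d (x 0) (x 2) (x 3)
  !![x 1 ^ 2 + 2 * C * x 1, -2 * D * x 1 * Real.sin (x 2);
     -2 * D * x 1 * Real.sin (x 2), Real.sin (x 2) ^ 2 * (x 1 ^ 2 - 2 * C * x 1)]

/-- `f = O(r^k)` as `r → ∞` along every ray on which `w`, `θ`, `φ` are constant. -/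
def IsOr (f : Pt → ℝ) (k : ℤ) : Prop :=
  ∀ w φ : ℝ, ∀ θ ∈ Set.Ioo 0 Real.pi,
    (fun r : ℝ => f (pt w r θ φ)) =O[atTop] (fun r : ℝ => r ^ k)

/-- The asymptotics of a metric in Bondi form and of an electromagnetic field. The coefficients
are `C¹` on an open set `Ω` which contains the far part of every ray; the expansions of `W` and
`σ` may be differentiated once. -/
structure HasAsymptotics (Ω : Set Pt) (B : Coeffs) (F : Pt → Matrix (Fin 4) (Fin 4) ℝ)
    (m c d X Y : ScriFun) : Prop where
  isOpen : IsOpen Ω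
  eventually_mem : ∀ w φ : ℝ, ∀ θ ∈ Set.Ioo 0 Real.pi, ∀ᶠ r in atTop, pt w r θ φ ∈ Ω
  contDiff_U : ContDiffOn ℝ 1 B.U Ω
  contDiff_V : ContDiffOn ℝ 1 B.V Ω
  contDiff_W : ∀ a, ContDiffOn ℝ 1 (fun x => B.W x a) Ω
  contDiff_σ : ∀ a b, ContDiffOn ℝ 1 (fun x => B.σ x a b) Ω
  contDiff_c : IsC1 c
  contDiff_d : IsC1 d
  symm_σ : ∀ x, (B.σ x).IsSymm
  asymp_V : IsOr (fun x => B.V x - (1 - 2 * m (x 0) (x 2) (x 3) / x 1)) (-2)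
  asymp_U : IsOr (fun x => B.U x - 1) (-2)
  asymp_W : ∀ a, IsOr (fun x => B.W x a) (-2)
  asymp_dW : ∀ a b, IsOr (pd (ang b) fun x => B.W x a) (-2)
  asymp_σ : ∀ a b, IsOr (fun x => B.σ x a b - sigmaLead c d x a b) 0
  asymp_dσ : ∀ a b μ, IsOr (pd μ fun x => B.σ x a b - sigmaLead c d x a b) 0
  skew_F : ∀ x μ ν, F x μ ν = - F x ν μ
  asymp_F_wθ : IsOr (fun x => F x 0 2 - X (x 0) (x 2) (x 3)) (-1)
  asymp_F_wφ : IsOr (fun x => F x 0 3 - Y (x 0) (x 2) (x 3) * Real.sin (x 2)) (-1)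
  asymp_F_ra : ∀ a, IsOr (fun x => F x 1 (ang a)) (-2)
  asymp_F_ab : ∀ a b, IsOr (fun x => F x (ang a) (ang b)) 0
  asymp_F_wr : IsOr (fun x => F x 0 1) (-2)

/-! ### Limits at null infinity, norms and mass loss laws -/

/-- `lim_{r → ∞} r A = Z` along the null hypersurfaces of constant `w`, for a family `A` of
covariant 2-tensors on the spheres `S_{w,r}`: the components of `r A` in the frame
`(r⁻¹ ∂_θ, r⁻¹ ∂_φ)` tend to those of the tensor `Z` of the unit sphere in `(∂_θ, ∂_φ)`. -/
def HasLimit2 (A : Pt → Matrix (Fin 2) (Fin 2) ℝ)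
    (Z : ℝ → ℝ → ℝ → Matrix (Fin 2) (Fin 2) ℝ) : Prop :=
  ∀ w φ : ℝ, ∀ θ ∈ Set.Ioo 0 Real.pi, ∀ a b,
    Tendsto (fun r : ℝ => r * (r⁻¹ * r⁻¹ * A (pt w r θ φ) a b)) atTop (𝓝 (Z w θ φ a b))

/-- The same for covariant 1-tensors. -/
def HasLimit1 (A : Pt → Fin 2 → ℝ) (Z : ℝ → ℝ → ℝ → Fin 2 → ℝ) : Prop :=
  ∀ w φ : ℝ, ∀ θ ∈ Set.Ioo 0 Real.pi, ∀ a,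
    Tendsto (fun r : ℝ => r * (r⁻¹ * A (pt w r θ φ) a)) atTop (𝓝 (Z w θ φ a))

/-- The round metric `dθ² + sin² θ dφ²` of the unit sphere. -/
def round (θ : ℝ) : Matrix (Fin 2) (Fin 2) ℝ := !![1, 0; 0, Real.sin θ ^ 2]

/-- The trace of a covariant 2-tensor for the round metric. -/
def roundTrace (θ : ℝ) (A : Matrix (Fin 2) (Fin 2) ℝ) : ℝ :=
  ∑ a, ∑ b, (round θ)⁻¹ a b * A a b

/-- The squared norm of a covariant 2-tensor for the round metric. -/
def normSq2 (θ : ℝ) (A : Matrix (Fin 2) (Fin 2) ℝ) : ℝ :=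
  ∑ a, ∑ b, ∑ a', ∑ b', (round θ)⁻¹ a a' * (round θ)⁻¹ b b' * A a b * A a' b'

/-- The squared norm of a covariant 1-tensor for the round metric. -/
def normSq1 (θ : ℝ) (A : Fin 2 → ℝ) : ℝ :=
  ∑ a, ∑ a', (round θ)⁻¹ a a' * A a * A a'

/-- The area measure of the unit sphere, in the chart `(θ, φ)`. -/
def sphereMeasure : Measure (ℝ × ℝ) :=
  (volume.restrict (Set.Ioo 0 Real.pi ×ˢ Set.Ioo 0 (2 * Real.pi))).withDensity
    fun p => ENNReal.ofReal (Real.sin p.1)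

/-- The Bondi mass `M(w) = (8 π)⁻¹ ∫_{S²} m`. -/
def bondiMass (m : ScriFun) (w : ℝ) : ℝ :=
  1 / (8 * Real.pi) * ∫ p, m w p.1 p.2 ∂sphereMeasure

/-- The mass loss formula `∂_u M = (8 π)⁻¹ ∫_{S²} (|Ξ|² + |A_F|² / 2)`, for the squared norms
of `Ξ` and `A_F` given as functions of `u` and the angles. -/
def NullFoliationMassLaw (M : ℝ → ℝ) (XiSq AFSq : ScriFun) : Prop :=
  ∀ u : ℝ,
    Integrable (fun p : ℝ × ℝ => XiSq u p.1 p.2 + 1 / 2 * AFSq u p.1 p.2) sphereMeasure ∧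
    HasDerivAt M
      (1 / (8 * Real.pi) *
        ∫ p, (XiSq u p.1 p.2 + 1 / 2 * AFSq u p.1 p.2) ∂sphereMeasure) u

/-- The mass loss formula in Bondi coordinates
`∂_w M = - (8 π)⁻¹ ∫_{S²} ((∂_w c)² + (∂_w d)² + (X² + Y²) / 2)`. -/
def BondiMassLaw (M : ℝ → ℝ) (c d X Y : ScriFun) : Prop :=
  ∀ w : ℝ,
    Integrable (fun p : ℝ × ℝ => dw c w p.1 p.2 ^ 2 + dw d w p.1 p.2 ^ 2
      + 1 / 2 * (X w p.1 p.2 ^ 2 + Y w p.1 p.2 ^ 2)) sphereMeasure ∧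
    HasDerivAt M
      (-(1 / (8 * Real.pi) *
        ∫ p, (dw c w p.1 p.2 ^ 2 + dw d w p.1 p.2 ^ 2
          + 1 / 2 * (X w p.1 p.2 ^ 2 + Y w p.1 p.2 ^ 2)) ∂sphereMeasure)) w

end Bondi

end

open Filter Topology Asymptotics MeasureTheory

namespace Bondi

/-! ### Partial derivatives -/

/-! For a field n normal to the spheres, ⟨∇_a n, ∂_b⟩ is half the Lie derivative of the metric along
n, in the angular components. It is therefore linear over functions in n: for n = p e₃ + q e₄ it
equals p `formE3` + q `formE4`, without derivatives of p and q (`secondForm_normal`).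

Write γ for the round metric and σ = r²γ + 2rK + O(1), where K is the trace-free matrix `shear`
built from c and d. After division by r, ∂_w σ leaves 2∂_wK because γ does not depend on w, ∂_r σ
leaves 2γ, and the terms with W vanish. Hence the forms of e₃ and e₄ tend to ∂_wK - γ/2 and γ, and
the trace-free part keeps only p ∂_wK (`tendsto_traceFree_secondForm`). The coefficients of e₃ in T,
N and T - N tend to 1/√2, -1/√2 and √2, so with the signs of the definitions all three limits are Ξ
= -∂_wK/√2. Since |∂_wK|² = 2((∂_w c)² + (∂_w d)²), the norm follows.

In α̲(F) only -F_{wa} survives. The integrands of the two mass laws then agree on the chart, and u =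
-w accounts for the sign. -/

theorem pd_add {μ : Fin 4} {f g : Pt → ℝ} {x : Pt} (hf : DifferentiableAt ℝ f x)
    (hg : DifferentiableAt ℝ g x) : pd μ (fun y => f y + g y) x = pd μ f x + pd μ g x := by
  simp only [pd]
  rw [fderiv_fun_add hf hg]; rfl

theorem pd_mul {μ : Fin 4} {f g : Pt → ℝ} {x : Pt} (hf : DifferentiableAt ℝ f x)
    (hg : DifferentiableAt ℝ g x) :
    pd μ (fun y => f y * g y) x = pd μ f x * g x + f x * pd μ g x := by
  simp only [pd]
  rw [fderiv_fun_mul hf hg]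
  simp only [add_apply, smul_apply, smul_eq_mul]
  ring

@[simp] theorem pd_const (μ : Fin 4) (k : ℝ) (x : Pt) : pd μ (fun _ => k) x = 0 := by
  simp [pd]

theorem pd_neg (μ : Fin 4) (f : Pt → ℝ) (x : Pt) : pd μ (fun y => - f y) x = - pd μ f x := by
  simp [pd]

/-- The partial derivative as a derivative along a coordinate line. -/
theorem pd_eq_deriv {μ : Fin 4} {f : Pt → ℝ} {x : Pt} (hf : DifferentiableAt ℝ f x) :
    pd μ f x = deriv (fun t => f (Function.update x μ t)) (x μ) := by
  have h1 : HasDerivAt (Function.update x μ) (basisVec μ) (x μ) := hasDerivAt_update x μ (x μ)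
  have h2 : HasFDerivAt f (fderiv ℝ f x) (Function.update x μ (x μ)) := by
    rw [Function.update_eq_self]; exact hf.hasFDerivAt
  exact (h2.comp_hasDerivAt (x μ) h1).deriv.symm

namespace Coeffs

variable (B : Coeffs)

/-! ### The metric -/

theorem metric_eq (x : Pt) : B.metric x =
    !![- B.U x * B.V x + ∑ a, ∑ b, B.σ x a b * B.W x a * B.W x b, - B.U x,
        ∑ a, B.σ x a 0 * B.W x a, ∑ a, B.σ x a 1 * B.W x a;
      - B.U x, 0, 0, 0;
      ∑ a, B.σ x 0 a * B.W x a, 0, B.σ x 0 0, B.σ x 0 1;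
      ∑ a, B.σ x 1 a * B.W x a, 0, B.σ x 1 0, B.σ x 1 1] := by
  ext i j
  fin_cases i <;> fin_cases j <;>
    simp [metric, ip, basisVec, ang, Fin.sum_univ_succ]

/-- Reduces invertibility of the metric to U ≠ 0 and det σ ≠ 0, which hold far out on each ray. -/
theorem det_metric (x : Pt) : (B.metric x).det = - B.U x ^ 2 * (B.σ x).det := by
  rw [metric_eq]
  simp [Matrix.det_succ_row_zero, Fin.sum_univ_succ, Fin.succAbove]
  ring

theorem ip_eq_sum (x u v : Pt) : B.ip x u v = ∑ μ, ∑ ν, B.metric x μ ν * u μ * v ν := by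
  rw [metric_eq]
  simp [ip, ang, Fin.sum_univ_succ]
  ring

theorem metric_symm (hσ : ∀ x, (B.σ x).IsSymm) (x : Pt) (μ ν : Fin 4) :
    B.metric x μ ν = B.metric x ν μ := by
  have h := (hσ x).apply 0 1
  rw [metric_eq]
  fin_cases μ <;> fin_cases ν <;> simp [h]

theorem ip_basisVec (hσ : ∀ x, (B.σ x).IsSymm) (x u : Pt) (ν : Fin 4) :
    B.ip x u (basisVec ν) = ∑ l, B.metric x ν l * u l := by
  rw [ip_eq_sum]
  refine Finset.sum_congr rfl fun l _ => ?_
  rw [Finset.sum_eq_single ν] <;> simp +contextual [basisVec, B.metric_symm hσ x l ν]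

theorem ip_e3_e3 (x : Pt) : B.ip x (B.e3 x) (B.e3 x) = 0 := by
  simp [ip, e3, ang]

theorem ip_e4_e4 (x : Pt) : B.ip x (B.e4 x) (B.e4 x) = 0 := by
  simp [ip, e4, ang, basisVec]

theorem ip_e3_angular (x : Pt) (a : Fin 2) : B.ip x (B.e3 x) (basisVec (ang a)) = 0 := by
  fin_cases a <;> simp [ip, e3, ang, basisVec]

theorem ip_e4_angular (x : Pt) (a : Fin 2) : B.ip x (B.e4 x) (basisVec (ang a)) = 0 := by
  fin_cases a <;> simp [ip, e4, ang, basisVec]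

theorem ip_e3_e4 (x : Pt) : B.ip x (B.e3 x) (B.e4 x) = - B.U x := by
  simp [ip, e3, e4, ang, basisVec]

/-! ### Second fundamental forms -/

/-- The lowered connection coefficients are the Christoffel symbols of the first kind. -/
theorem sum_metric_mul_christoffel {g : Pt → Matrix (Fin 4) (Fin 4) ℝ} {x : Pt}
    (hg : IsUnit (g x).det) (ρ μ ν : Fin 4) :
    ∑ l, g x ρ l * christoffel g x l μ ν = (1 / 2) * (pd μ (fun y => g y ν ρ) x
      + pd ν (fun y => g y μ ρ) x - pd ρ (fun y => g y μ ν) x) := by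
  -- Lowering the index cancels the inverse metric, so g⁻¹ never has to be computed.
  have h1 : ∀ κ, ∑ l, g x ρ l * (g x)⁻¹ l κ = (1 : Matrix (Fin 4) (Fin 4) ℝ) ρ κ := fun κ => by
    rw [← Matrix.mul_nonsing_inv _ hg, Matrix.mul_apply]
  simp only [christoffel, Finset.mul_sum]
  rw [Finset.sum_comm]
  have h2 : ∀ κ, ∑ l, g x ρ l * (1 / 2 * ((g x)⁻¹ l κ * (pd μ (fun y => g y ν κ) x
      + pd ν (fun y => g y μ κ) x - pd κ (fun y => g y μ ν) x))) =
      (1 : Matrix (Fin 4) (Fin 4) ℝ) ρ κ * (1 / 2 * (pd μ (fun y => g y ν κ) x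
      + pd ν (fun y => g y μ κ) x - pd κ (fun y => g y μ ν) x)) := fun κ => by
    rw [← h1, Finset.sum_mul]
    exact Finset.sum_congr rfl fun l _ => by ring
  simp only [h2, Matrix.one_apply, ite_mul, one_mul, zero_mul, Finset.sum_ite_eq,
    Finset.mem_univ, if_true]

theorem secondForm_apply (hσ : ∀ x, (B.σ x).IsSymm) {x : Pt} (hg : IsUnit (B.metric x).det)
    (n : Pt → Pt) (a b : Fin 2) :
    B.secondForm n x a b = ∑ l, B.metric x (ang b) l * pd (ang a) (fun y => n y l) x
      + ∑ ν, (1 / 2) * (pd (ang a) (fun y => B.metric y ν (ang b)) x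
        + pd ν (fun y => B.metric y (ang a) (ang b)) x
        - pd (ang b) (fun y => B.metric y (ang a) ν) x) * n x ν := by
  simp only [secondForm, Matrix.of_apply, B.ip_basisVec hσ, covDeriv, mul_add,
    Finset.sum_add_distrib]
  congr 1
  simp only [← sum_metric_mul_christoffel hg, Finset.mul_sum, Finset.sum_mul]
  rw [Finset.sum_comm]
  exact Finset.sum_congr rfl fun _ _ => Finset.sum_congr rfl fun _ _ => by ring

/-- `⟨∇_a e₃, ∂_b⟩` in terms of the coefficients. -/
noncomputable def formE3 (x : Pt) (a b : Fin 2) : ℝ :=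
  1 / 2 * pd 0 (fun y => B.σ y a b) x - 1 / 4 * B.V x * pd 1 (fun y => B.σ y a b) x
    - 1 / 2 * ∑ c, (B.W x c * pd (ang c) (fun y => B.σ y a b) x
      + B.σ x b c * pd (ang a) (fun y => B.W y c) x
      + B.σ x a c * pd (ang b) (fun y => B.W y c) x)

/-- `⟨∇_a e₄, ∂_b⟩` in terms of the coefficients. -/
noncomputable def formE4 (x : Pt) (a b : Fin 2) : ℝ := 1 / 2 * pd 1 (fun y => B.σ y a b) x

variable {B} in
-- Derivatives of p cancel because e₃ is orthogonal to ∂_b. Derivatives of q and V occur only in the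
-- r-component of the field, which is paired with g_{rb} = 0, so these functions need not be
-- differentiable.
theorem secondForm_normal (hσ : ∀ x, (B.σ x).IsSymm) {x : Pt} (hg : IsUnit (B.metric x).det)
    (dW : ∀ a, DifferentiableAt ℝ (fun y => B.W y a) x)
    (dσ : ∀ a b, DifferentiableAt ℝ (fun y => B.σ y a b) x) {p q : Pt → ℝ}
    (dp : DifferentiableAt ℝ p x) (a b : Fin 2) :
    B.secondForm (fun y => p y • B.e3 y + q y • B.e4 y) x a b
      = p x * B.formE3 x a b + q x * B.formE4 x a b := by
  have hs : ∀ y, B.σ y 1 0 = B.σ y 0 1 := fun y => (hσ y).apply 0 1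
  have hpW : ∀ c μ, pd μ (fun y => p y * - B.W y c) x
      = - (pd μ p x * B.W x c + p x * pd μ (fun y => B.W y c) x) := fun c μ => by
    rw [pd_mul dp (dW c).fun_neg, pd_neg]; ring
  have hσW : ∀ i j k l μ, pd μ (fun y => B.σ y i j * B.W y 0 + B.σ y k l * B.W y 1) x =
      pd μ (fun y => B.σ y i j) x * B.W x 0 + B.σ x i j * pd μ (fun y => B.W y 0) x
      + (pd μ (fun y => B.σ y k l) x * B.W x 1 + B.σ x k l * pd μ (fun y => B.W y 1) x) :=
    fun i j k l μ => by
      rw [pd_add ((dσ i j).fun_mul (dW 0)) ((dσ k l).fun_mul (dW 1)), pd_mul (dσ i j) (dW 0),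
        pd_mul (dσ k l) (dW 1)]
  rw [B.secondForm_apply hσ hg]
  -- `-mul_neg` keeps the products p * -W in the shape that `hpW` rewrites.
  fin_cases a <;> fin_cases b <;>
    simp [metric_eq, formE3, formE4, e3, e4, basisVec, ang, Fin.sum_univ_succ, hs, hpW, hσW,
      -mul_neg] <;> ring

end Coeffs
end Bondi

namespace Bondi

/-! ### Limits along rays -/

section Rays

variable {w θ φ : ℝ}

@[simp] theorem pt_zero (w r θ φ : ℝ) : pt w r θ φ 0 = w := rfl
@[simp] theorem pt_one (w r θ φ : ℝ) : pt w r θ φ 1 = r := rfl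
@[simp] theorem pt_two (w r θ φ : ℝ) : pt w r θ φ 2 = θ := rfl
@[simp] theorem pt_three (w r θ φ : ℝ) : pt w r θ φ 3 = φ := rfl

theorem IsOr.tendsto_mul_zpow {f : Pt → ℝ} {k : ℤ} (h : IsOr f k) (hθ : θ ∈ Set.Ioo 0 Real.pi)
    (j : ℤ) (hj : k + j < 0) :
    Tendsto (fun r => f (pt w r θ φ) * r ^ j) atTop (𝓝 0) := by
  have h1 : (fun r : ℝ => f (pt w r θ φ) * r ^ j) =O[atTop] fun r : ℝ => r ^ (k + j) := by
    refine ((h w φ θ hθ).mul (isBigO_refl (fun r : ℝ => r ^ j) atTop)).congr' EventuallyEq.rfl ?_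
    filter_upwards [eventually_ne_atTop 0] with r hr
    rw [zpow_add₀ hr]
  refine h1.trans_tendsto ?_
  obtain ⟨n, hn⟩ := Int.eq_ofNat_of_zero_le (a := -(k + j)) (by omega)
  have hn' : k + j = -(n : ℤ) := by omega
  have : n ≠ 0 := by omega
  simp only [hn', zpow_neg, zpow_natCast]
  exact (tendsto_pow_atTop (α := ℝ) this).inv_tendsto_atTop

theorem IsOr.tendsto_zero {f : Pt → ℝ} {k : ℤ} (h : IsOr f k) (hθ : θ ∈ Set.Ioo 0 Real.pi)
    (hk : k < 0) : Tendsto (fun r => f (pt w r θ φ)) atTop (𝓝 0) := by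
  simpa using h.tendsto_mul_zpow (w := w) (φ := φ) hθ 0 (by omega)

/-! ### Functions on null infinity as functions on space-time -/

/-- The function of `(w, r, θ, φ)` that does not depend on `r`. -/
def pull (f : ScriFun) (x : Pt) : ℝ := f (x 0) (x 2) (x 3)

theorem differentiableAt_pull {f : ScriFun} (hf : IsC1 f) (r : ℝ) (hθ : θ ∈ Set.Ioo 0 Real.pi) :
    DifferentiableAt ℝ (pull f) (pt w r θ φ) := by
  have ho : IsOpen {y : ℝ × ℝ × ℝ | y.2.1 ∈ Set.Ioo 0 Real.pi} :=
    isOpen_Ioo.preimage (by fun_prop)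
  have h1 : DifferentiableAt ℝ (fun y : ℝ × ℝ × ℝ => f y.1 y.2.1 y.2.2) (w, θ, φ) :=
    (hf.differentiableOn one_ne_zero).differentiableAt (ho.mem_nhds hθ)
  have h2 : DifferentiableAt ℝ (fun x : Pt => (x 0, x 2, x 3)) (pt w r θ φ) := by fun_prop
  exact DifferentiableAt.comp (g := fun y : ℝ × ℝ × ℝ => f y.1 y.2.1 y.2.2) (pt w r θ φ) h1 h2

theorem differentiableAt_dw {f : ScriFun} (hf : IsC1 f) (hθ : θ ∈ Set.Ioo 0 Real.pi) :
    DifferentiableAt ℝ (fun s => f s θ φ) w := by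
  have h : DifferentiableAt ℝ (fun s => pt s 0 θ φ) w := by
    rw [differentiableAt_pi]
    intro i
    fin_cases i <;> simp [pt]
  exact DifferentiableAt.comp (g := pull f) (f := fun s => pt s 0 θ φ) w
    (differentiableAt_pull hf 0 hθ) h

theorem pd_zero_pull {f : ScriFun} (hf : IsC1 f) (r : ℝ) (hθ : θ ∈ Set.Ioo 0 Real.pi) :
    pd 0 (pull f) (pt w r θ φ) = dw f w θ φ := by
  rw [pd_eq_deriv (differentiableAt_pull hf r hθ)]
  simp [pull, dw]

theorem pd_one_pull {f : ScriFun} (hf : IsC1 f) (r : ℝ) (hθ : θ ∈ Set.Ioo 0 Real.pi) :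
    pd 1 (pull f) (pt w r θ φ) = 0 := by
  rw [pd_eq_deriv (differentiableAt_pull hf r hθ)]
  simp [pull]

/-- Makes the derivatives of functions on null infinity constant along a ray; they can then be
evaluated at r = 0. -/
theorem pd_pull_eq {f : ScriFun} (hf : IsC1 f) (μ : Fin 4) (hμ : μ ≠ 1) (r s : ℝ)
    (hθ : θ ∈ Set.Ioo 0 Real.pi) :
    pd μ (pull f) (pt w r θ φ) = pd μ (pull f) (pt w s θ φ) := by
  rw [pd_eq_deriv (differentiableAt_pull hf r hθ), pd_eq_deriv (differentiableAt_pull hf s hθ)]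
  fin_cases μ <;> simp_all [pull]

/-! ### The leading part of the angular metric -/

/-- The coefficient of `2 r` in the expansion of `σ`. -/
noncomputable def shear (C D θ : ℝ) : Matrix (Fin 2) (Fin 2) ℝ :=
  !![C, -D * Real.sin θ; -D * Real.sin θ, -Real.sin θ ^ 2 * C]

variable {c d : ScriFun}

theorem isC1_round (a b : Fin 2) : IsC1 fun _ θ _ => round θ a b := by
  unfold IsC1
  fin_cases a <;> fin_cases b <;> simp [round] <;> fun_prop

theorem isC1_shear (hc : IsC1 c) (hd : IsC1 d) (a b : Fin 2) :
    IsC1 fun w θ φ => 2 * shear (c w θ φ) (d w θ φ) θ a b := by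
  unfold IsC1 at *
  fin_cases a <;> fin_cases b <;> simp [shear] <;> fun_prop

theorem dw_shear (hc : IsC1 c) (hd : IsC1 d) (hθ : θ ∈ Set.Ioo 0 Real.pi) (a b : Fin 2) :
    dw (fun w θ φ => 2 * shear (c w θ φ) (d w θ φ) θ a b) w θ φ
      = 2 * shear (dw c w θ φ) (dw d w θ φ) θ a b := by
  have h1 := (differentiableAt_dw (w := w) (φ := φ) hc hθ).hasDerivAt
  have h2 := (differentiableAt_dw (w := w) (φ := φ) hd hθ).hasDerivAt
  refine HasDerivAt.deriv (HasDerivAt.const_mul 2 ?_)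
  fin_cases a <;> fin_cases b
  · exact h1
  · exact h2.neg.mul_const _
  · exact h2.neg.mul_const _
  · exact h1.const_mul _

/-- Separates the powers of r from functions on null infinity, ready for the product rule. -/
theorem sigmaLead_eq (x : Pt) (a b : Fin 2) : sigmaLead c d x a b =
    x 1 * x 1 * pull (fun _ θ _ => round θ a b) x
      + x 1 * pull (fun w θ φ => 2 * shear (c w θ φ) (d w θ φ) θ a b) x := by
  fin_cases a <;> fin_cases b <;> simp [sigmaLead, pull, round, shear] <;> ring

theorem differentiableAt_sigmaLead (hc : IsC1 c) (hd : IsC1 d) (r : ℝ)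
    (hθ : θ ∈ Set.Ioo 0 Real.pi) (a b : Fin 2) :
    DifferentiableAt ℝ (fun x => sigmaLead c d x a b) (pt w r θ φ) := by
  simp only [sigmaLead_eq]
  have h1 := differentiableAt_pull (w := w) (φ := φ) (isC1_round a b) r hθ
  have h2 := differentiableAt_pull (w := w) (φ := φ) (isC1_shear hc hd a b) r hθ
  fun_prop

theorem pd_sigmaLead (hc : IsC1 c) (hd : IsC1 d) (r : ℝ) (hθ : θ ∈ Set.Ioo 0 Real.pi)
    (a b : Fin 2) (μ : Fin 4) :
    pd μ (fun x => sigmaLead c d x a b) (pt w r θ φ) =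
      2 * r * basisVec μ 1 * round θ a b
      + r * r * pd μ (pull fun _ θ _ => round θ a b) (pt w r θ φ)
      + (basisVec μ 1 * (2 * shear (c w θ φ) (d w θ φ) θ a b)
      + r * pd μ (pull fun w θ φ => 2 * shear (c w θ φ) (d w θ φ) θ a b) (pt w r θ φ)) := by
  simp only [sigmaLead_eq]
  have h1 := differentiableAt_pull (w := w) (φ := φ) (isC1_round a b) r hθ
  have h2 := differentiableAt_pull (w := w) (φ := φ) (isC1_shear hc hd a b) r hθ
  have h3 : DifferentiableAt ℝ (fun x : Pt => x 1) (pt w r θ φ) := by fun_prop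
  have h4 : pd μ (fun x : Pt => x 1) (pt w r θ φ) = basisVec μ 1 := by
    simp only [pd]
    rw [fderiv_apply (by fun_prop)]
    simp
  rw [pd_add ((h3.fun_mul h3).fun_mul h1) (h3.fun_mul h2), pd_mul (h3.fun_mul h3) h1,
    pd_mul h3 h2, pd_mul h3 h3, h4]
  simp only [pt_one]
  simp only [pull, pt_zero, pt_two, pt_three]
  ring

end Rays
end Bondi

namespace Bondi

/-! ### Trace-free parts -/

theorem tendsto_matrix_inv {S : ℝ → Matrix (Fin 2) (Fin 2) ℝ} {S₀ : Matrix (Fin 2) (Fin 2) ℝ}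
    (hS : Tendsto S atTop (𝓝 S₀)) (h0 : S₀.det ≠ 0) :
    Tendsto (fun r => (S r)⁻¹) atTop (𝓝 S₀⁻¹) := by
  refine (continuousAt_matrix_inv S₀ ?_).tendsto.comp hS
  simpa [Ring.inverse_eq_inv'] using continuousAt_inv₀ h0

theorem det_round (θ : ℝ) : (round θ).det = Real.sin θ ^ 2 := by
  simp [round, Matrix.det_fin_two]

theorem det_round_pos {θ : ℝ} (hθ : θ ∈ Set.Ioo 0 Real.pi) : 0 < (round θ).det := by
  rw [det_round]
  exact pow_pos (Real.sin_pos_of_pos_of_lt_pi hθ.1 hθ.2) 2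

theorem round_inv {θ : ℝ} (hθ : θ ∈ Set.Ioo 0 Real.pi) :
    (round θ)⁻¹ = !![1, 0; 0, (Real.sin θ ^ 2)⁻¹] := by
  have h := (Real.sin_pos_of_pos_of_lt_pi hθ.1 hθ.2).ne'
  refine Matrix.inv_eq_right_inv ?_
  ext i j
  fin_cases i <;> fin_cases j <;> simp [round, Matrix.mul_apply, Fin.sum_univ_two, h]

section

variable {w θ φ : ℝ}

/-- Taking the trace-free part is linear in A and unaffected by rescaling σ. So σ may be replaced by
r⁻²σ, which tends to the round metric, and A by r⁻¹A, since r · r⁻² = r⁻¹. -/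
theorem Coeffs.tendsto_traceFree {B : Coeffs} {A : Pt → Matrix (Fin 2) (Fin 2) ℝ}
    {Z : Matrix (Fin 2) (Fin 2) ℝ} (hθ : θ ∈ Set.Ioo 0 Real.pi)
    (hσ : Tendsto (fun r : ℝ => (r ^ 2)⁻¹ • B.σ (pt w r θ φ)) atTop (𝓝 (round θ)))
    (hA : ∀ a b, Tendsto (fun r : ℝ => r⁻¹ * A (pt w r θ φ) a b) atTop (𝓝 (Z a b)))
    (a b : Fin 2) :
    Tendsto (fun r : ℝ => r * (r⁻¹ * r⁻¹ * B.traceFree (pt w r θ φ) (A (pt w r θ φ)) a b))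
      atTop (𝓝 (Z a b - 1 / 2 * roundTrace θ Z * round θ a b)) := by
  have hS : ∀ a b, Tendsto (fun r : ℝ => ((r ^ 2)⁻¹ • B.σ (pt w r θ φ)) a b) atTop
      (𝓝 (round θ a b)) := fun a b => tendsto_pi_nhds.1 (tendsto_pi_nhds.1 hσ a) b
  have hI : ∀ a b, Tendsto (fun r : ℝ => ((r ^ 2)⁻¹ • B.σ (pt w r θ φ))⁻¹ a b) atTop
      (𝓝 ((round θ)⁻¹ a b)) := fun a b =>
    tendsto_pi_nhds.1 (tendsto_pi_nhds.1 (tendsto_matrix_inv hσ (det_round_pos hθ).ne') a) b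
  -- The limit determinant is sin²θ > 0, so far out the matrix inverse of σ is a true inverse.
  have hdet : ∀ᶠ r : ℝ in atTop, ((r ^ 2)⁻¹ • B.σ (pt w r θ φ)).det ≠ 0 :=
    ((Continuous.matrix_det continuous_id).tendsto _ |>.comp hσ).eventually_ne
      (det_round_pos hθ).ne'
  refine ((hA a b).sub (((tendsto_finsetSum Finset.univ fun i _ =>
    tendsto_finsetSum Finset.univ fun j _ => (hI i j).mul (hA i j)).const_mul (1 / 2)).mul
      (hS a b))).congr' ?_
  filter_upwards [hdet, eventually_ne_atTop 0] with r hr hr0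
  have hr2 : (r ^ 2)⁻¹ ≠ 0 := by positivity
  have hdet' : IsUnit (B.σ (pt w r θ φ)).det := by
    rw [Matrix.det_smul] at hr
    exact (right_ne_zero_of_mul hr).isUnit
  have hinv := Matrix.inv_smul' (B.σ (pt w r θ φ)) (Units.mk0 _ hr2) hdet'
  rw [Units.smul_mk0] at hinv
  rw [hinv]
  simp only [traceFree, Matrix.sub_apply, Matrix.smul_apply, smul_eq_mul, Fin.sum_univ_two,
    Units.smul_def, Units.val_inv_eq_inv_val, Units.val_mk0]
  field_simp

theorem shear_symm (C D θ : ℝ) : (shear C D θ).IsSymm := by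
  ext i j
  fin_cases i <;> fin_cases j <;> simp [shear]

theorem roundTrace_smul_shear (k C D : ℝ) (hθ : θ ∈ Set.Ioo 0 Real.pi) :
    roundTrace θ (k • shear C D θ) = 0 := by
  have h := (Real.sin_pos_of_pos_of_lt_pi hθ.1 hθ.2).ne'
  simp only [roundTrace, round_inv hθ, shear, Fin.sum_univ_two]
  simp
  field_simp
  ring

theorem normSq2_smul_shear (k C D : ℝ) (hθ : θ ∈ Set.Ioo 0 Real.pi) :
    normSq2 θ (k • shear C D θ) = 2 * k ^ 2 * (C ^ 2 + D ^ 2) := by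
  have h := (Real.sin_pos_of_pos_of_lt_pi hθ.1 hθ.2).ne'
  simp only [normSq2, round_inv hθ, shear, Fin.sum_univ_two]
  simp
  field_simp
  ring

theorem normSq1_neg_frame (x y : ℝ) (hθ : θ ∈ Set.Ioo 0 Real.pi) :
    normSq1 θ ![-x, -(y * Real.sin θ)] = x ^ 2 + y ^ 2 := by
  have h := (Real.sin_pos_of_pos_of_lt_pi hθ.1 hθ.2).ne'
  simp only [normSq1, round_inv hθ, Fin.sum_univ_two]
  simp
  field_simp

/-- The trace part of `k K + l γ` drops out when `K` is trace-free. -/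
theorem traceFree_smul_shear_add (k l C D : ℝ) (hθ : θ ∈ Set.Ioo 0 Real.pi) (a b : Fin 2) :
    (k • shear C D θ + l • round θ) a b
      - 1 / 2 * roundTrace θ (k • shear C D θ + l • round θ) * round θ a b
      = (k • shear C D θ) a b := by
  have h := (Real.sin_pos_of_pos_of_lt_pi hθ.1 hθ.2).ne'
  have htr : roundTrace θ (k • shear C D θ + l • round θ) = 2 * l := by
    simp only [roundTrace, round_inv hθ, Fin.sum_univ_two]
    simp [shear, round]
    field_simp
    ring
  rw [htr]
  simp only [Matrix.add_apply, Matrix.smul_apply, smul_eq_mul]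
  ring

/-! ### Limits of the coefficients -/

namespace HasAsymptotics

variable {Ω : Set Pt} {B : Coeffs} {F : Pt → Matrix (Fin 4) (Fin 4) ℝ} {m c d X Y : ScriFun}
  (h : HasAsymptotics Ω B F m c d X Y)

include h

theorem tendsto_U (hθ : θ ∈ Set.Ioo 0 Real.pi) :
    Tendsto (fun r => B.U (pt w r θ φ)) atTop (𝓝 1) := by
  simpa using (h.asymp_U.tendsto_zero (w := w) (φ := φ) hθ (by norm_num)).add_const 1

theorem tendsto_V (hθ : θ ∈ Set.Ioo 0 Real.pi) :
    Tendsto (fun r => B.V (pt w r θ φ)) atTop (𝓝 1) := by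
  have h1 := h.asymp_V.tendsto_zero (w := w) (φ := φ) hθ (by norm_num)
  have h2 : Tendsto (fun r : ℝ => 1 - 2 * m w θ φ / r) atTop (𝓝 (1 - 0)) :=
    tendsto_const_nhds.sub (tendsto_const_nhds.div_atTop tendsto_id)
  simpa using h1.add h2

theorem tendsto_W (hθ : θ ∈ Set.Ioo 0 Real.pi) (a : Fin 2) :
    Tendsto (fun r => r * B.W (pt w r θ φ) a) atTop (𝓝 0) := by
  simpa [mul_comm] using (h.asymp_W a).tendsto_mul_zpow (w := w) (φ := φ) hθ 1 (by norm_num)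

theorem tendsto_pd_W (hθ : θ ∈ Set.Ioo 0 Real.pi) (a b : Fin 2) :
    Tendsto (fun r => r * pd (ang b) (fun x => B.W x a) (pt w r θ φ)) atTop (𝓝 0) := by
  simpa [mul_comm] using (h.asymp_dW a b).tendsto_mul_zpow (w := w) (φ := φ) hθ 1 (by norm_num)

theorem tendsto_σ (hθ : θ ∈ Set.Ioo 0 Real.pi) (a b : Fin 2) :
    Tendsto (fun r => (r ^ 2)⁻¹ * B.σ (pt w r θ φ) a b) atTop (𝓝 (round θ a b)) := by
  have h1 := (h.asymp_σ a b).tendsto_mul_zpow (w := w) (φ := φ) hθ (-2) (by norm_num)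
  have h2 : Tendsto (fun r : ℝ => r⁻¹ * (2 * shear (c w θ φ) (d w θ φ) θ a b)) atTop (𝓝 0) := by
    simpa using tendsto_inv_atTop_zero.mul_const (2 * shear (c w θ φ) (d w θ φ) θ a b)
  have h3 := (h1.add h2).add_const (round θ a b)
  simp only [add_zero, zero_add] at h3
  refine h3.congr' ?_
  filter_upwards [eventually_ne_atTop 0] with r hr
  rw [sigmaLead_eq, zpow_neg]
  simp only [pull, pt_zero, pt_one, pt_two, pt_three]
  norm_cast
  field_simp
  ring

theorem tendsto_smul_σ (hθ : θ ∈ Set.Ioo 0 Real.pi) :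
    Tendsto (fun r : ℝ => (r ^ 2)⁻¹ • B.σ (pt w r θ φ)) atTop (𝓝 (round θ)) :=
  tendsto_pi_nhds.2 fun a => tendsto_pi_nhds.2 fun b => h.tendsto_σ hθ a b

theorem eventually_differentiableAt_σ (hθ : θ ∈ Set.Ioo 0 Real.pi) :
    ∀ᶠ r in atTop, ∀ a b, DifferentiableAt ℝ (fun x => B.σ x a b) (pt w r θ φ) := by
  filter_upwards [h.eventually_mem w φ θ hθ] with r hr a b
  exact ((h.contDiff_σ a b).differentiableOn one_ne_zero).differentiableAt
    (h.isOpen.mem_nhds hr)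

theorem eventually_differentiableAt_W (hθ : θ ∈ Set.Ioo 0 Real.pi) :
    ∀ᶠ r in atTop, ∀ a, DifferentiableAt ℝ (fun x => B.W x a) (pt w r θ φ) := by
  filter_upwards [h.eventually_mem w φ θ hθ] with r hr a
  exact ((h.contDiff_W a).differentiableOn one_ne_zero).differentiableAt
    (h.isOpen.mem_nhds hr)

theorem eventually_differentiableAt_U (hθ : θ ∈ Set.Ioo 0 Real.pi) :
    ∀ᶠ r in atTop, DifferentiableAt ℝ B.U (pt w r θ φ) := by
  filter_upwards [h.eventually_mem w φ θ hθ] with r hr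
  exact (h.contDiff_U.differentiableOn one_ne_zero).differentiableAt (h.isOpen.mem_nhds hr)

/-- The derivatives of `σ`, up to an error `O(1)`. -/
theorem tendsto_pd_σ_sub (hθ : θ ∈ Set.Ioo 0 Real.pi) (a b : Fin 2) (μ : Fin 4) :
    Tendsto (fun r => r⁻¹ * pd μ (fun x => B.σ x a b) (pt w r θ φ)
      - r⁻¹ * pd μ (fun x => sigmaLead c d x a b) (pt w r θ φ)) atTop (𝓝 0) := by
  refine ((h.asymp_dσ a b μ).tendsto_mul_zpow (w := w) (φ := φ) hθ (-1) (by norm_num)).congr' ?_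
  filter_upwards [h.eventually_differentiableAt_σ (w := w) (φ := φ) hθ] with r hr
  have h1 := differentiableAt_sigmaLead (w := w) (φ := φ) h.contDiff_c h.contDiff_d r hθ a b
  have h2 : pd μ (fun x => B.σ x a b - sigmaLead c d x a b) (pt w r θ φ)
      = pd μ (fun x => B.σ x a b) (pt w r θ φ)
        - pd μ (fun x => sigmaLead c d x a b) (pt w r θ φ) := by
    simp only [pd]
    rw [fderiv_fun_sub (hr a b) h1, sub_apply]
  rw [h2, zpow_neg, zpow_one]
  ring

/-- The r² part of σ does not depend on w, so the shear term is the leading one here. -/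
theorem tendsto_pd_zero_σ (hθ : θ ∈ Set.Ioo 0 Real.pi) (a b : Fin 2) :
    Tendsto (fun r => r⁻¹ * pd 0 (fun x => B.σ x a b) (pt w r θ φ)) atTop
      (𝓝 (2 * shear (dw c w θ φ) (dw d w θ φ) θ a b)) := by
  have h1 := (h.tendsto_pd_σ_sub (w := w) (φ := φ) hθ a b 0).add_const
    (2 * shear (dw c w θ φ) (dw d w θ φ) θ a b)
  rw [zero_add] at h1
  refine h1.congr' ?_
  filter_upwards [eventually_ne_atTop 0] with r hr
  rw [pd_sigmaLead h.contDiff_c h.contDiff_d r hθ, pd_zero_pull (isC1_round a b) r hθ,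
    pd_zero_pull (isC1_shear h.contDiff_c h.contDiff_d a b) r hθ,
    dw_shear h.contDiff_c h.contDiff_d hθ]
  simp [basisVec, dw, hr]

theorem tendsto_pd_one_σ (hθ : θ ∈ Set.Ioo 0 Real.pi) (a b : Fin 2) :
    Tendsto (fun r => r⁻¹ * pd 1 (fun x => B.σ x a b) (pt w r θ φ)) atTop
      (𝓝 (2 * round θ a b)) := by
  have h2 : Tendsto (fun r : ℝ => r⁻¹ * (2 * shear (c w θ φ) (d w θ φ) θ a b)) atTop (𝓝 0) := by
    simpa using tendsto_inv_atTop_zero.mul_const (2 * shear (c w θ φ) (d w θ φ) θ a b)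
  have h1 := ((h.tendsto_pd_σ_sub (w := w) (φ := φ) hθ a b 1).add h2).add_const
    (2 * round θ a b)
  simp only [zero_add] at h1
  refine h1.congr' ?_
  filter_upwards [eventually_ne_atTop 0] with r hr
  rw [pd_sigmaLead h.contDiff_c h.contDiff_d r hθ, pd_one_pull (isC1_round a b) r hθ,
    pd_one_pull (isC1_shear h.contDiff_c h.contDiff_d a b) r hθ]
  simp [basisVec]
  field_simp
  ring

/-- The value of the limit is irrelevant: this factor is later multiplied by rW, which tends to 0.
-/
theorem exists_tendsto_pd_ang_σ (hθ : θ ∈ Set.Ioo 0 Real.pi) (a b e : Fin 2) :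
    ∃ L, Tendsto (fun r => (r ^ 2)⁻¹ * pd (ang e) (fun x => B.σ x a b) (pt w r θ φ)) atTop
      (𝓝 L) := by
  have he : ang e ≠ 1 := by fin_cases e <;> simp [ang]
  set P := pd (ang e) (pull fun _ θ _ => round θ a b) (pt w 0 θ φ) with hP
  set Q := pd (ang e) (pull fun w θ φ => 2 * shear (c w θ φ) (d w θ φ) θ a b) (pt w 0 θ φ)
    with hQ
  refine ⟨P, ?_⟩
  have h1 := tendsto_inv_atTop_zero.mul
    ((h.tendsto_pd_σ_sub (w := w) (φ := φ) hθ a b (ang e)).add_const Q)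
  have h2 := h1.add_const P
  simp only [zero_mul, zero_add] at h2
  refine h2.congr' ?_
  filter_upwards [eventually_ne_atTop 0] with r hr
  rw [pd_sigmaLead h.contDiff_c h.contDiff_d r hθ,
    pd_pull_eq (isC1_round a b) _ he r 0 hθ,
    pd_pull_eq (isC1_shear h.contDiff_c h.contDiff_d a b) _ he r 0 hθ, ← hP, ← hQ]
  simp only [basisVec, Pi.single_eq_of_ne he.symm]
  field_simp
  ring

/-! ### Limits of the second fundamental forms -/

theorem tendsto_formE4 (hθ : θ ∈ Set.Ioo 0 Real.pi) (a b : Fin 2) :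
    Tendsto (fun r => r⁻¹ * B.formE4 (pt w r θ φ) a b) atTop (𝓝 (round θ a b)) := by
  have h1 := (h.tendsto_pd_one_σ (w := w) (φ := φ) hθ a b).const_mul (1 / 2)
  convert h1 using 2
  · rw [Coeffs.formE4]; ring
  · ring

theorem tendsto_formE3 (hθ : θ ∈ Set.Ioo 0 Real.pi) (a b : Fin 2) :
    Tendsto (fun r => r⁻¹ * B.formE3 (pt w r θ φ) a b) atTop
      (𝓝 (shear (dw c w θ φ) (dw d w θ φ) θ a b - 1 / 2 * round θ a b)) := by
  -- Each term splits into a convergent factor, r⁻²∂σ or r⁻²σ, and one tending to 0, rW or r∂W.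
  have hz : ∀ e : Fin 2, Tendsto (fun r => r⁻¹ * (B.W (pt w r θ φ) e
      * pd (ang e) (fun y => B.σ y a b) (pt w r θ φ)
      + B.σ (pt w r θ φ) b e * pd (ang a) (fun y => B.W y e) (pt w r θ φ)
      + B.σ (pt w r θ φ) a e * pd (ang b) (fun y => B.W y e) (pt w r θ φ))) atTop (𝓝 0) := by
    intro e
    obtain ⟨L, hL⟩ := h.exists_tendsto_pd_ang_σ (w := w) (φ := φ) hθ a b e
    have h1 := (((h.tendsto_W (w := w) (φ := φ) hθ e).mul hL).add
      ((h.tendsto_σ (w := w) (φ := φ) hθ b e).mul (h.tendsto_pd_W (w := w) (φ := φ) hθ e a))).add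
      ((h.tendsto_σ (w := w) (φ := φ) hθ a e).mul (h.tendsto_pd_W (w := w) (φ := φ) hθ e b))
    simp only [zero_mul, mul_zero, add_zero] at h1
    refine h1.congr' ?_
    filter_upwards [eventually_ne_atTop 0] with r hr
    field_simp
  have h1 := (((h.tendsto_pd_zero_σ (w := w) (φ := φ) hθ a b).const_mul (1 / 2)).sub
    (((h.tendsto_V (w := w) (φ := φ) hθ).const_mul (1 / 4)).mul
      (h.tendsto_pd_one_σ (w := w) (φ := φ) hθ a b))).sub
    ((tendsto_finsetSum Finset.univ fun e _ => hz e).const_mul (1 / 2))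
  convert h1 using 2
  · rw [Coeffs.formE3, ← Finset.mul_sum]; ring
  · simp; ring

/-- The limit of the trace-free part of the second fundamental form for a combination of the null
normals. -/
theorem tendsto_traceFree_secondForm (hθ : θ ∈ Set.Ioo 0 Real.pi) {p q : Pt → ℝ} {p₀ q₀ : ℝ}
    (dp : ∀ᶠ r in atTop, DifferentiableAt ℝ p (pt w r θ φ))
    (hp : Tendsto (fun r => p (pt w r θ φ)) atTop (𝓝 p₀))
    (hq : Tendsto (fun r => q (pt w r θ φ)) atTop (𝓝 q₀)) (a b : Fin 2) :
    Tendsto (fun r : ℝ => r * (r⁻¹ * r⁻¹ * B.traceFree (pt w r θ φ)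
      (B.secondForm (fun y => p y • B.e3 y + q y • B.e4 y) (pt w r θ φ)) a b))
      atTop (𝓝 ((p₀ • shear (dw c w θ φ) (dw d w θ φ) θ) a b)) := by
  -- The multiple of the round metric collects -1/2 from e₃ and 1 from e₄; it is pure trace.
  rw [← traceFree_smul_shear_add p₀ (q₀ - 1 / 2 * p₀) _ _ hθ]
  refine Coeffs.tendsto_traceFree hθ (h.tendsto_smul_σ hθ) (fun a b => ?_) a b
  have h1 := (hp.mul (h.tendsto_formE3 (w := w) (φ := φ) hθ a b)).add
    (hq.mul (h.tendsto_formE4 (w := w) (φ := φ) hθ a b))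
  have hdet : ∀ᶠ r : ℝ in atTop, ((r ^ 2)⁻¹ • B.σ (pt w r θ φ)).det ≠ 0 :=
    ((Continuous.matrix_det continuous_id).tendsto _ |>.comp
      (h.tendsto_smul_σ hθ)).eventually_ne (det_round_pos hθ).ne'
  have hU := (h.tendsto_U (w := w) (φ := φ) hθ).eventually_ne one_ne_zero
  have h2 : (p₀ • shear (dw c w θ φ) (dw d w θ φ) θ + (q₀ - 1 / 2 * p₀) • round θ) a b
      = p₀ * (shear (dw c w θ φ) (dw d w θ φ) θ a b - 1 / 2 * round θ a b)
        + q₀ * round θ a b := by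
    simp only [Matrix.add_apply, Matrix.smul_apply, smul_eq_mul]
    ring
  rw [h2]
  refine h1.congr' ?_
  filter_upwards [hdet, hU, dp, h.eventually_differentiableAt_W hθ,
    h.eventually_differentiableAt_σ hθ] with r hr hUr hpr hWr hσr
  have hg : IsUnit (B.metric (pt w r θ φ)).det := by
    rw [Coeffs.det_metric]
    rw [Matrix.det_smul] at hr
    exact (mul_ne_zero (neg_ne_zero.2 (pow_ne_zero 2 hUr)) (right_ne_zero_of_mul hr)).isUnit
  rw [Coeffs.secondForm_normal h.symm_σ hg hWr hσr hpr]
  ring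

end HasAsymptotics
end
end Bondi

namespace Bondi

/-! ### The unit normals and the limits Ξ and A_F -/

section

variable {w θ φ : ℝ}

/-- The factor of `e₄ ± e₃` in the unit normals `N` and `T`. -/
noncomputable def Coeffs.lapse (B : Coeffs) (x : Pt) : ℝ :=
  (Real.sqrt (-2 * B.ip x (B.e3 x) (B.e4 x)))⁻¹

theorem Coeffs.lapse_eq (B : Coeffs) : B.lapse = fun x => (Real.sqrt (2 * B.U x))⁻¹ := by
  funext x
  rw [Coeffs.lapse, Coeffs.ip_e3_e4, neg_mul_neg]

theorem Coeffs.T_eq (B : Coeffs) : B.T = fun y => B.lapse y • B.e3 y + B.lapse y • B.e4 y := by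
  funext y
  rw [← smul_add]; rfl

theorem Coeffs.N_eq (B : Coeffs) :
    B.N = fun y => (-B.lapse y) • B.e3 y + B.lapse y • B.e4 y := by
  funext y
  rw [neg_smul, neg_add_eq_sub, ← smul_sub]; rfl

theorem Coeffs.T_sub_N_eq (B : Coeffs) :
    (fun y => B.T y - B.N y) = fun y => (2 * B.lapse y) • B.e3 y + (0 : ℝ) • B.e4 y := by
  funext y
  rw [B.T_eq, B.N_eq]
  module

theorem Coeffs.traceFree_smul (B : Coeffs) (x : Pt) (k : ℝ) (A : Matrix (Fin 2) (Fin 2) ℝ) :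
    B.traceFree x (k • A) = k • B.traceFree x A := by
  ext i j
  simp only [Coeffs.traceFree, Matrix.sub_apply, Matrix.smul_apply, smul_eq_mul,
    Fin.sum_univ_two]
  ring

/-- The limit of `r` times the trace-free part of `η`. -/
noncomputable def limitShear (c d : ScriFun) (w θ φ : ℝ) : Matrix (Fin 2) (Fin 2) ℝ :=
  (-(Real.sqrt 2)⁻¹) • shear (dw c w θ φ) (dw d w θ φ) θ

/-- The limit of `r` times `α̲(F)`. -/
noncomputable def limitAlphaBar (X Y : ScriFun) (w θ φ : ℝ) : Fin 2 → ℝ :=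
  ![-X w θ φ, -(Y w θ φ * Real.sin θ)]

/-- The square 1/2 of the factor -1/√2 cancels the 2 in the norm of the shear matrix. -/
theorem normSq2_limitShear (c d : ScriFun) (hθ : θ ∈ Set.Ioo 0 Real.pi) :
    normSq2 θ (limitShear c d w θ φ) = dw c w θ φ ^ 2 + dw d w θ φ ^ 2 := by
  rw [limitShear, normSq2_smul_shear _ _ _ hθ, neg_sq, inv_pow, Real.sq_sqrt zero_le_two]
  ring

namespace HasAsymptotics

variable {Ω : Set Pt} {B : Coeffs} {F : Pt → Matrix (Fin 4) (Fin 4) ℝ} {m c d X Y : ScriFun}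
  (h : HasAsymptotics Ω B F m c d X Y)

include h

theorem tendsto_lapse (hθ : θ ∈ Set.Ioo 0 Real.pi) :
    Tendsto (fun r => B.lapse (pt w r θ φ)) atTop (𝓝 (Real.sqrt 2)⁻¹) := by
  rw [B.lapse_eq]
  have h1 := (((h.tendsto_U (w := w) (φ := φ) hθ).const_mul 2).sqrt).inv₀
    (by rw [mul_one]; positivity)
  rwa [mul_one] at h1

theorem eventually_differentiableAt_lapse (hθ : θ ∈ Set.Ioo 0 Real.pi) :
    ∀ᶠ r in atTop, DifferentiableAt ℝ B.lapse (pt w r θ φ) := by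
  rw [B.lapse_eq]
  -- Square root and inverse are differentiable away from 0, and U → 1 makes U positive far out.
  filter_upwards [h.eventually_differentiableAt_U (w := w) (φ := φ) hθ,
    (h.tendsto_U (w := w) (φ := φ) hθ).eventually_const_lt zero_lt_one] with r hr hpos
  have h2 : 0 < 2 * B.U (pt w r θ φ) := by positivity
  exact ((hr.const_mul 2).sqrt h2.ne').fun_inv (Real.sqrt_pos.2 h2).ne'

theorem hasLimit2_eta : HasLimit2 (fun x => B.traceFree x (B.eta x)) (limitShear c d) := by
  intro w φ θ hθ a b
  have h1 := (h.tendsto_traceFree_secondForm hθ (h.eventually_differentiableAt_lapse hθ)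
    (h.tendsto_lapse hθ) (h.tendsto_lapse (w := w) (φ := φ) hθ) a b).neg
  convert h1 using 2
  · simp only [Coeffs.eta]
    rw [B.T_eq, ← neg_one_smul ℝ, B.traceFree_smul, Matrix.smul_apply, smul_eq_mul]
    ring
  · rw [limitShear, neg_smul, Matrix.neg_apply]

theorem hasLimit2_theta : HasLimit2 (fun x => B.traceFree x (B.theta x)) (limitShear c d) := by
  intro w φ θ hθ a b
  have h1 := h.tendsto_traceFree_secondForm (p := fun y => -B.lapse y) hθ
    ((h.eventually_differentiableAt_lapse hθ).mono fun _ hr => hr.fun_neg)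
    (h.tendsto_lapse hθ).neg (h.tendsto_lapse (w := w) (φ := φ) hθ) a b
  rw [← B.N_eq] at h1
  exact h1

/-- T - N is twice the lapse times e₃, and -1/2 · 2/√2 = -1/√2. -/
theorem hasLimit2_chiBar :
    HasLimit2 (fun x => (-(1 / 2) : ℝ) • B.traceFree x (B.chiBar x)) (limitShear c d) := by
  intro w φ θ hθ a b
  have h1 := (h.tendsto_traceFree_secondForm (p := fun y => 2 * B.lapse y) (q := fun _ => 0) hθ
    ((h.eventually_differentiableAt_lapse hθ).mono fun _ hr => hr.const_mul 2)
    ((h.tendsto_lapse (w := w) (φ := φ) hθ).const_mul 2) tendsto_const_nhds a b).const_mul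
    (-(1 / 2))
  rw [← B.T_sub_N_eq] at h1
  convert h1 using 2
  · simp only [Coeffs.chiBar, Matrix.smul_apply, smul_eq_mul]
    ring
  · rw [limitShear, Matrix.smul_apply, Matrix.smul_apply, smul_eq_mul, smul_eq_mul]
    ring

/-- F(∂_a, e₃) = -F_{wa} + (V/2) F_{ra} - W^c F_{ac}, and the last two terms tend to 0. The weight r
cancels against the frame factor r⁻¹. -/
theorem hasLimit1_alphaBar : HasLimit1 (fun x => B.alphaBar F x) (limitAlphaBar X Y) := by
  intro w φ θ hθ a
  have hW : ∀ e, Tendsto (fun r => B.W (pt w r θ φ) e * F (pt w r θ φ) (ang a) (ang e)) atTop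
      (𝓝 0) := fun e => by
    have h1 := (h.tendsto_W (w := w) (φ := φ) hθ e).mul
      ((h.asymp_F_ab a e).tendsto_mul_zpow (w := w) (φ := φ) hθ (-1) (by norm_num))
    rw [zero_mul] at h1
    refine h1.congr' ?_
    filter_upwards [eventually_ne_atTop 0] with r hr
    rw [zpow_neg, zpow_one]
    field_simp
  have hr : Tendsto (fun r => B.V (pt w r θ φ) / 2 * F (pt w r θ φ) 1 (ang a)) atTop (𝓝 0) := by
    simpa using ((h.tendsto_V (w := w) (φ := φ) hθ).div_const 2).mul
      ((h.asymp_F_ra a).tendsto_zero (w := w) (φ := φ) hθ (by norm_num))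
  have hw : Tendsto (fun r => -F (pt w r θ φ) 0 (ang a)) atTop
      (𝓝 (limitAlphaBar X Y w θ φ a)) := by
    fin_cases a
    · simpa [ang, limitAlphaBar] using
        ((h.asymp_F_wθ.tendsto_zero (w := w) (φ := φ) hθ (by norm_num)).add_const
          (X w θ φ)).neg
    · simpa [ang, limitAlphaBar] using
        ((h.asymp_F_wφ.tendsto_zero (w := w) (φ := φ) hθ (by norm_num)).add_const
          (Y w θ φ * Real.sin θ)).neg
  have h1 := ((hw.add hr).sub (hW 0)).sub (hW 1)
  simp only [add_zero, sub_zero] at h1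
  refine h1.congr' ?_
  filter_upwards [eventually_ne_atTop 0] with r hr0
  rw [mul_inv_cancel_left₀ hr0, Coeffs.alphaBar, Fin.sum_univ_four, h.skew_F _ (ang a) 0,
    h.skew_F _ (ang a) 1]
  simp [Coeffs.e3, ang]
  ring

end HasAsymptotics

/-! ### Mass loss -/

/-- The norm identities need sin θ ≠ 0, so they hold almost everywhere for this measure. -/
theorem ae_sphereMeasure_mem : ∀ᵐ p ∂sphereMeasure, p.1 ∈ Set.Ioo 0 Real.pi := by
  refine (withDensity_absolutelyContinuous _ _).ae_le ?_
  filter_upwards [ae_restrict_mem (measurableSet_Ioo.prod measurableSet_Ioo)] with p hp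
  exact hp.1

/-- The two mass loss formulae agree for every function `M`, with `u = -w`. -/
theorem nullFoliationMassLaw_iff (M : ℝ → ℝ) (c d X Y : ScriFun) :
    NullFoliationMassLaw (fun u => M (-u)) (fun u θ φ => normSq2 θ (limitShear c d (-u) θ φ))
      (fun u θ φ => normSq1 θ (limitAlphaBar X Y (-u) θ φ)) ↔ BondiMassLaw M c d X Y := by
  have hae : ∀ w, (fun p : ℝ × ℝ => normSq2 p.1 (limitShear c d w p.1 p.2)
      + 1 / 2 * normSq1 p.1 (limitAlphaBar X Y w p.1 p.2)) =ᵐ[sphereMeasure]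
      fun p => dw c w p.1 p.2 ^ 2 + dw d w p.1 p.2 ^ 2
        + 1 / 2 * (X w p.1 p.2 ^ 2 + Y w p.1 p.2 ^ 2) := fun w => by
    filter_upwards [ae_sphereMeasure_mem] with p hp
    rw [normSq2_limitShear c d hp, limitAlphaBar, normSq1_neg_frame _ _ hp]
  have hderiv : ∀ (k w : ℝ), HasDerivAt (fun u => M (-u)) k (-w) ↔ HasDerivAt M (-k) w := by
    intro k w
    constructor
    · intro hk
      have h1 := HasDerivAt.scomp w hk (hasDerivAt_neg w)
      simpa [Function.comp_def] using h1
    · intro hk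
      have h1 : HasDerivAt M (-k) (- -w) := by rwa [neg_neg]
      simpa [Function.comp_def] using HasDerivAt.scomp (-w) h1 (hasDerivAt_neg (-w))
  -- The double negation is what the law in u, whose integrand is taken at -u, gives at u = -w.
  have key : ∀ w, (Integrable (fun p : ℝ × ℝ => normSq2 p.1 (limitShear c d (- -w) p.1 p.2)
      + 1 / 2 * normSq1 p.1 (limitAlphaBar X Y (- -w) p.1 p.2)) sphereMeasure ∧
      HasDerivAt (fun u => M (-u)) (1 / (8 * Real.pi) *
        ∫ p, (normSq2 p.1 (limitShear c d (- -w) p.1 p.2)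
          + 1 / 2 * normSq1 p.1 (limitAlphaBar X Y (- -w) p.1 p.2)) ∂sphereMeasure) (-w)) ↔
      (Integrable (fun p : ℝ × ℝ => dw c w p.1 p.2 ^ 2 + dw d w p.1 p.2 ^ 2
        + 1 / 2 * (X w p.1 p.2 ^ 2 + Y w p.1 p.2 ^ 2)) sphereMeasure ∧
      HasDerivAt M (-(1 / (8 * Real.pi) *
        ∫ p, (dw c w p.1 p.2 ^ 2 + dw d w p.1 p.2 ^ 2
          + 1 / 2 * (X w p.1 p.2 ^ 2 + Y w p.1 p.2 ^ 2)) ∂sphereMeasure)) w) := fun w => by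
    rw [neg_neg, integrable_congr (hae w), integral_congr_ae (hae w), hderiv]
  exact ⟨fun H w => (key w).1 (H (-w)), fun H u => by
    have := (key (-u)).2 (H (-u))
    simp only [neg_neg] at this
    exact this⟩

end
end Bondi

theorem mainTheorem4 (Ω : Set Bondi.Pt) (B : Bondi.Coeffs)
    (F : Bondi.Pt → Matrix (Fin 4) (Fin 4) ℝ) (m c d X Y : Bondi.ScriFun)
    (h : Bondi.HasAsymptotics Ω B F m c d X Y) :
    -- `e₃`, `e₄` are null and normal to the spheres, `⟨e₃, e₄⟩ → -1`
    (∀ x, B.ip x (B.e3 x) (B.e3 x) = 0 ∧ B.ip x (B.e4 x) (B.e4 x) = 0 ∧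
      ∀ a, B.ip x (B.e3 x) (Bondi.basisVec (Bondi.ang a)) = 0 ∧
        B.ip x (B.e4 x) (Bondi.basisVec (Bondi.ang a)) = 0) ∧
    (∀ w φ : ℝ, ∀ θ ∈ Set.Ioo 0 Real.pi,
      Filter.Tendsto (fun r => B.ip (Bondi.pt w r θ φ) (B.e3 (Bondi.pt w r θ φ))
        (B.e4 (Bondi.pt w r θ φ))) Filter.atTop (nhds (-1))) ∧
    -- the limits `Ξ` and `A_F`
    ∃ (Ξ : ℝ → ℝ → ℝ → Matrix (Fin 2) (Fin 2) ℝ) (AF : ℝ → ℝ → ℝ → Fin 2 → ℝ),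
      Bondi.HasLimit2 (fun x => B.traceFree x (B.eta x)) Ξ ∧
      Bondi.HasLimit2 (fun x => B.traceFree x (B.theta x)) Ξ ∧
      Bondi.HasLimit2 (fun x => (-(1 / 2) : ℝ) • B.traceFree x (B.chiBar x)) Ξ ∧
      Bondi.HasLimit1 (fun x => B.alphaBar F x) AF ∧
      (∀ w φ : ℝ, ∀ θ ∈ Set.Ioo 0 Real.pi,
        (Ξ w θ φ).IsSymm ∧ Bondi.roundTrace θ (Ξ w θ φ) = 0 ∧
        Bondi.normSq2 θ (Ξ w θ φ) = Bondi.dw c w θ φ ^ 2 + Bondi.dw d w θ φ ^ 2 ∧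
        Bondi.normSq1 θ (AF w θ φ) = X w θ φ ^ 2 + Y w θ φ ^ 2) ∧
      -- the two mass loss formulae agree, with `u = -w`
      (∀ M : ℝ → ℝ,
        Bondi.NullFoliationMassLaw (fun u => M (-u))
          (fun u θ φ => Bondi.normSq2 θ (Ξ (-u) θ φ))
          (fun u θ φ => Bondi.normSq1 θ (AF (-u) θ φ)) ↔
        Bondi.BondiMassLaw M c d X Y) ∧
      (Bondi.NullFoliationMassLaw (fun u => Bondi.bondiMass m (-u))
          (fun u θ φ => Bondi.normSq2 θ (Ξ (-u) θ φ))
          (fun u θ φ => Bondi.normSq1 θ (AF (-u) θ φ)) ↔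
        Bondi.BondiMassLaw (Bondi.bondiMass m) c d X Y) := by
  refine ⟨fun x => ⟨B.ip_e3_e3 x, B.ip_e4_e4 x, fun a =>
    ⟨B.ip_e3_angular x a, B.ip_e4_angular x a⟩⟩, fun w φ θ hθ => ?_,
    Bondi.limitShear c d, Bondi.limitAlphaBar X Y, h.hasLimit2_eta, h.hasLimit2_theta,
    h.hasLimit2_chiBar, h.hasLimit1_alphaBar, fun w φ θ hθ => ⟨?_, ?_, ?_, ?_⟩,
    fun M => Bondi.nullFoliationMassLaw_iff M c d X Y,
    Bondi.nullFoliationMassLaw_iff _ c d X Y⟩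
  · simpa only [Bondi.Coeffs.ip_e3_e4] using (h.tendsto_U (w := w) (φ := φ) hθ).neg
  · exact (Bondi.shear_symm _ _ _).smul _
  · exact Bondi.roundTrace_smul_shear _ _ _ hθ
  · exact Bondi.normSq2_limitShear c d hθ
  · exact Bondi.normSq1_neg_frame _ _ hθ
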